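/- **Definitions.** A higher dimensional automaton (HDA) over an alphabet $\Sigma$ consists of sets $Q_k$ ($k\ge 0$) of $k$-cells, total face maps $s_i,t_i:Q_k\to Q_{k-1}$ ($1\le i\le k$) with the cubical laws $\alpha_i\beta_j=\beta_{j-1}\alpha_i$ for $i<j$ and $\alpha,\beta\in\{s,t\}$, an initial cell $I\in Q_0$ and a labelling $l:Q_1\to\Sigma$ with $l(s_i(q))=l(t_i(q))$ for $q\in Q_2$. Morphisms are dimension preserving maps that preserve initial cell, labels and face maps. A path is a sequence of s-steps $s_i(q)\to q$ and t-steps $q\to t_i(q)$; it is rooted if it starts in $I$. Homotopy of rooted paths is the equivalence relation generated by replacing two consecutive steps, for $i<j$: $\xrightarrow{s_i}\xrightarrow{s_j}$ by $\xrightarrow{s_{j-1}}\xrightarrow{s_i}$, $\xrightarrow{t_j}\xrightarrow{t_i}$ by $\xrightarrow{t_i}\xrightarrow{t_{j-1}}$, $\xrightarrow{s_i}\xrightarrow{t_j}$ by $\xrightarrow{t_{j-1}}\xrightarrow{s_i}$, $\xrightarrow{s_j}\xrightarrow{t_i}$ by $\xrightarrow{t_i}\xrightarrow{s_{j-1}}$.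 HDAs are assumed to be reachable: every cell is the end of a rooted path. The bulk $B_n$ is the labelled $n$-cube as an HDA, with top cell $q_n$, whose initial cell is the corner reached from $q_n$ by s-maps only. A sculpture is a triple $(H,B_n,em)$ with $n\in\mathbb N$ and an injective morphism $em:H\to B_n$. It is simplistic if $em(H)$ is not contained in the smaller bulk spanned by a face $s_i(q_n)$. An ST-structure over $\Sigma$ is a set $E$ of events, labelled in $\Sigma$, with a set of pairs $(S,T)$ of finite sets $T\subseteq S\subseteq E$ (ST-configurations) that with $(S,T)$ contains $(S,S)$. Two ST-structures are isomorphic if there is a label preserving bijection of their events under which their ST-configurations correspond to each other. *Path-based translation.* Two transitions of $B_n$ are equivalent if they are related by the reflexive and transitive closure of the relation "$\alpha_i(q)$ and $\beta_i(q)$ for some square $q$ of $B_n$, some $i$ and some $\alpha,\beta\in\{s,t\}$". The event $[q]$ of a transition $q$ of $H$ is the class of $em(q)$; it has the label of $q$. Pairs are associated with the rooted paths of $H$ by the rules: the empty path gets $(\emptyset,\emptyset)$; a path $\pi$ to a transition $q$ gets $(S\cup\{[q]\},T)$ if $\pi$ is homotopic to $\pi'\xrightarrow{s}q$ and $\pi'$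 gets $(S,T)$; a path $\pi\xrightarrow{t}q_0$, where $\pi$ ends in a transition $q$ and gets $(S,T)$, gets $(S,T\cup\{[q]\})$; a path $\pi$ to a cell $q$ of dimension $\ge 2$ gets $(S\cup S',T\cup T')$ if for some $i\ne j$ it is homotopic to $\pi'\xrightarrow{s_i}q$ and to $\pi''\xrightarrow{s_j}q$, where $\pi'$ gets $(S,T)$ and $\pi''$ gets $(S',T')$. The ST-configurations of $\mathsf{ST}_{\mathrm{path}}$ are all pairs that arise in this way, and its events are the classes $[q]$ of the transitions $q$ of $H$. $\mathsf{ST}^{B}_{\mathrm{path}}$ is the same with all equivalence classes of transitions of $B_n$ as events. *Chain translation.* The events of $\mathsf{ST}_{\mathrm{chain}}$ are the list $E=[e_1,\dots,e_n]$ of the $n$ directions of $B_n$, with their labels. The map $s_i$ (resp. $t_i$) sends $(S,T)$ to $(S\setminus\{e\},T)$ (resp. $(S,T\cup\{e\})$), where $e$ is the $i$-th element of $S\setminus T$ in the order of $E$. The ST-configurations are the pairs $\alpha(E,\emptyset)$ for all cells $q$ of $H$ and all chains $\alpha=\alpha_{i_1}\circ\dots\circ\alpha_{i_k}$ of s/t-maps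 with $\alpha(q_n)=em(q)$. **Theorem.** Let $(H,B_n,em)$ be a sculpture with $H$ reachable. Then $\mathsf{ST}^{B}_{\mathrm{path}}$, $\mathsf{ST}_{\mathrm{path}}$ and $\mathsf{ST}_{\mathrm{chain}}$ are ST-structures, and $$\mathsf{ST}^{B}_{\mathrm{path}}\cong\mathsf{ST}_{\mathrm{chain}}.$$ Moreover $\mathsf{ST}_{\mathrm{path}}$ is isomorphic to $\mathsf{ST}_{\mathrm{chain}}$ restricted to the events that occur in its configurations; and if the sculpture is simplistic, then $\mathsf{ST}_{\mathrm{path}}\cong\mathsf{ST}_{\mathrm{chain}}$. -/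

import Mathlib

/-! ### Higher dimensional automata -/

/-- The two kinds of face maps: `src` for the maps `s_i`, `tgt` for the maps `t_i`. -/
inductive Side where
  | src : Side
  | tgt : Side

universe u v w

/-- A higher dimensional automaton over the alphabet `A` (final cells play no role here): a
cubical set with (total) face maps `face src i = s_{i+1}` and `face tgt i = t_{i+1}` (the indices
are counted from `0`), an initial cell and a labelling of the transitions. -/
structure HDA (A : Type u) where
  /-- `Q n` is the set of cells of dimension `n`. -/
  Q : ℕ → Type v
  face : Side → {n : ℕ} → Fin (n + 1) → Q (n + 1) → Q n
  /-- The cubical laws `α_i ∘ β_j = β_{j-1} ∘ α_i` for `i < j`. -/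
  cubical : ∀ (a b : Side) {n : ℕ} (i j : Fin (n + 1)), i ≤ j → ∀ q : Q (n + 2),
    face a i (face b j.succ q) = face b j (face a i.castSucc q)
  init : Q 0
  label : Q 1 → A
  label_face : ∀ (q : Q 2) (i : Fin 2), label (face .src i q) = label (face .tgt i q)

namespace HDA

variable {A : Type u}

/-- A cell of any dimension. -/
abbrev Cell (H : HDA.{u, v} A) : Type v := Σ n, H.Q n

/-- `H.IsFace a i p q`: the cell `q` is the `i`-th face of the cell `p` of kind `a`. -/
inductive IsFace (H : HDA.{u, v} A) : Side → ℕ → H.Cell → H.Cell → Prop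
  | mk (a : Side) {n : ℕ} (i : Fin (n + 1)) (q : H.Q (n + 1)) :
      IsFace H a i ⟨n + 1, q⟩ ⟨n, H.face a i q⟩

/-- Single steps: `up` is an s-step from `s_i(q)` to `q`, `down` is a t-step from `q` to
`t_i(q)`. -/
inductive Step (H : HDA.{u, v} A) : H.Cell → H.Cell → Type v
  | up {x y : H.Cell} (i : ℕ) (h : H.IsFace .src i y x) : Step H x y
  | down {x y : H.Cell} (i : ℕ) (h : H.IsFace .tgt i x y) : Step H x y

/-- Finite rooted paths, i.e. those that start in the initial cell. -/
inductive RPath (H : HDA.{u, v} A) : H.Cell → Type v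
  | nil : RPath H ⟨0, H.init⟩
  | snoc {x y : H.Cell} (p : RPath H x) (st : H.Step x y) : RPath H y

/-- Elementary replacements of a segment of two consecutive steps, by the four cubical laws. -/
inductive Replace (H : HDA.{u, v} A) : {x : H.Cell} → H.RPath x → H.RPath x → Prop
  | ss {x q q' y : H.Cell} (p : H.RPath x) (i j : ℕ) (hij : i ≤ j)
      (h₁ : H.IsFace .src i q x) (h₂ : H.IsFace .src (j + 1) y q)
      (h₃ : H.IsFace .src j q' x) (h₄ : H.IsFace .src i y q') :
      Replace H ((p.snoc (.up i h₁)).snoc (.up (j + 1) h₂)) ((p.snoc (.up j h₃)).snoc (.up i h₄))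
  | tt {x q q' y : H.Cell} (p : H.RPath x) (i j : ℕ) (hij : i ≤ j)
      (h₁ : H.IsFace .tgt (j + 1) x q) (h₂ : H.IsFace .tgt i q y)
      (h₃ : H.IsFace .tgt i x q') (h₄ : H.IsFace .tgt j q' y) :
      Replace H ((p.snoc (.down (j + 1) h₁)).snoc (.down i h₂))
        ((p.snoc (.down i h₃)).snoc (.down j h₄))
  | st {x q q' y : H.Cell} (p : H.RPath x) (i j : ℕ) (hij : i ≤ j)
      (h₁ : H.IsFace .src i q x) (h₂ : H.IsFace .tgt (j + 1) q y)
      (h₃ : H.IsFace .tgt j x q') (h₄ : H.IsFace .src i y q') :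
      Replace H ((p.snoc (.up i h₁)).snoc (.down (j + 1) h₂))
        ((p.snoc (.down j h₃)).snoc (.up i h₄))
  | ts {x q q' y : H.Cell} (p : H.RPath x) (i j : ℕ) (hij : i ≤ j)
      (h₁ : H.IsFace .src (j + 1) q x) (h₂ : H.IsFace .tgt i q y)
      (h₃ : H.IsFace .tgt i x q') (h₄ : H.IsFace .src j y q') :
      Replace H ((p.snoc (.up (j + 1) h₁)).snoc (.down i h₂))
        ((p.snoc (.down i h₃)).snoc (.up j h₄))
  | snoc {x y : H.Cell} {p p' : H.RPath x} (st : H.Step x y) (h : Replace H p p') :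
      Replace H (p.snoc st) (p'.snoc st)

/-- Homotopy of rooted paths: the equivalence relation generated by adjacency. -/
def Homotopic (H : HDA.{u, v} A) {x : H.Cell} : H.RPath x → H.RPath x → Prop :=
  Relation.EqvGen H.Replace

/-- Every cell is the end of a rooted path. -/
def IsReachable (H : HDA.{u, v} A) : Prop := ∀ x : H.Cell, Nonempty (H.RPath x)

/-- Two transitions are parallel if they are the `i`-th faces of one square, for the same `i`. -/
def Parallel (H : HDA.{u, v} A) (q q' : H.Q 1) : Prop :=
  ∃ (q₂ : H.Q 2) (i : Fin 2) (a b : Side), H.face a i q₂ = q ∧ H.face b i q₂ = q'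

theorem Parallel.label_eq {H : HDA.{u, v} A} {q q' : H.Q 1} (h : H.Parallel q q') :
    H.label q = H.label q' := by
  obtain ⟨q₂, i, a, b, rfl, rfl⟩ := h
  cases a <;> cases b <;> simp [H.label_face]

/-- The equivalence of transitions: the reflexive and transitive closure of being parallel (which
is a symmetric relation). -/
def eventEquiv (H : HDA.{u, v} A) : Setoid (H.Q 1) where
  r := Relation.ReflTransGen H.Parallel
  iseqv :=
    { refl := fun _ => .refl
      symm := fun h => by
        induction h with
        | refl => exact .refl
        | tail _ h ih =>
          obtain ⟨q₂, i, a, b, h₁, h₂⟩ := h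
          exact .head ⟨q₂, i, b, a, h₂, h₁⟩ ih
      trans := fun h h' => h.trans h' }

theorem label_eq_of_eventEquiv {H : HDA.{u, v} A} {q q' : H.Q 1}
    (h : H.eventEquiv.r q q') : H.label q = H.label q' := by
  induction h with
  | refl => rfl
  | tail _ h ih => exact ih.trans h.label_eq

/-- Morphisms of higher dimensional automata. -/
structure Hom (H : HDA.{u, v} A) (H' : HDA.{u, w} A) where
  toFun : {n : ℕ} → H.Q n → H'.Q n
  map_init : toFun H.init = H'.init
  map_label : ∀ q : H.Q 1, H'.label (toFun q) = H.label q
  map_face : ∀ (a : Side) {n : ℕ} (i : Fin (n + 1)) (q : H.Q (n + 1)),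
    H'.face a i (toFun q) = toFun (H.face a i q)

/-- Chains `α_{i₁} ∘ ⋯ ∘ α_{iₖ}` of face maps with correct indices, that can be applied to cells of
dimension `n` and give cells of dimension `m`; `comp a i c` is the composite `α_i ∘ c`. -/
inductive Chain (n : ℕ) : ℕ → Type
  | nil : Chain n n
  | comp (a : Side) {m : ℕ} (i : Fin (m + 1)) (c : Chain n (m + 1)) : Chain n m

/-- The cell obtained by applying a chain to a cell. -/
def Chain.apply (H : HDA.{u, v} A) {n : ℕ} : {m : ℕ} → Chain n m → H.Q n → H.Q m
  | _, .nil, q => q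
  | _, .comp a i c, q => H.face a i (c.apply H q)

end HDA

/-! ### Bulks -/

/-- The state of an event: not started, executing, terminated. -/
inductive Phase where
  | idle : Phase
  | busy : Phase
  | finished : Phase
  deriving DecidableEq

/-- The phase of an event in an `s`-face, respectively `t`-face, that corresponds to it. -/
def Side.phase : Side → Phase
  | .src => .idle
  | .tgt => .finished

namespace Bulk

variable {n : ℕ}

/-- The set of the coordinates in which a cell of the cube extends. -/
def busy (x : Fin n → Phase) : Finset (Fin n) := Finset.univ.filter fun e => x e = .busy

/-- The `k`-dimensional cells of the `n`-cube. -/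
abbrev Q (n k : ℕ) : Type := {x : Fin n → Phase // (busy x).card = k}

theorem busy_update (x : Fin n → Phase) (e : Fin n) (a : Side) :
    busy (Function.update x e a.phase) = (busy x).erase e := by
  ext d
  by_cases h : d = e
  · subst h
    simp only [busy, Finset.mem_filter, Function.update_self, Finset.mem_erase]
    cases a <;> simp [Side.phase]
  · simp only [busy, Finset.mem_filter, Finset.mem_erase]; simp [h]

/-- The `i`-th coordinate in which a cell extends. -/
def dir {k : ℕ} (q : Q n k) (i : Fin k) : Fin n := (busy q.1).orderEmbOfFin q.2 i

theorem dir_mem {k : ℕ} (q : Q n k) (i : Fin k) : dir q i ∈ busy q.1 :=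
  Finset.orderEmbOfFin_mem _ _ _

/-- The `i`-th faces of a cell: its `i`-th busy coordinate becomes idle, respectively finished. -/
def face (a : Side) {k : ℕ} (i : Fin (k + 1)) (q : Q n (k + 1)) : Q n k :=
  ⟨Function.update q.1 (dir q i) a.phase, by
    rw [busy_update, Finset.card_erase_of_mem (dir_mem q i), q.2, Nat.add_sub_cancel]⟩

theorem dir_face (a : Side) {k : ℕ} (j : Fin (k + 1)) (q : Q n (k + 1)) (i : Fin k) :
    dir (face a j q) i = dir q (j.succAbove i) := by
  have h : (Fin.succAboveOrderEmb j).trans ((busy q.1).orderEmbOfFin q.2) =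
      (busy (face a j q).1).orderEmbOfFin (face a j q).2 := by
    apply Finset.orderEmbOfFin_unique'
    intro i
    have : busy (face a j q).1 = (busy q.1).erase (dir q j) := busy_update _ _ _
    rw [this, Finset.mem_erase]
    refine ⟨fun h => ?_, Finset.orderEmbOfFin_mem _ q.2 _⟩
    exact Fin.succAbove_ne j i (((busy q.1).orderEmbOfFin q.2).injective h)
  exact (DFunLike.congr_fun h i).symm

theorem dir_ne {k : ℕ} (q : Q n k) {i j : Fin k} (h : i ≠ j) : dir q i ≠ dir q j :=
  fun h' => h (((busy q.1).orderEmbOfFin q.2).injective h')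

theorem cubical (a b : Side) {k : ℕ} (i j : Fin (k + 1)) (hij : i ≤ j) (q : Q n (k + 2)) :
    face a i (face b j.succ q) = face b j (face a i.castSucc q) := by
  apply Subtype.ext
  change Function.update (Function.update q.1 (dir q j.succ) b.phase)
      (dir (face b j.succ q) i) a.phase =
    Function.update (Function.update q.1 (dir q i.castSucc) a.phase)
      (dir (face a i.castSucc q) j) b.phase
  rw [dir_face, dir_face, Fin.succAbove_succ_of_le _ _ hij, Fin.succAbove_castSucc_of_le _ _ hij]
  apply Function.update_comm
  exact dir_ne q (Fin.ne_of_gt (Fin.castSucc_lt_succ_iff.mpr hij))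

/-- The `n`-dimensional bulk: the cube with `n` directions, the initial cell being the corner where
no event has started. In a labelled cube all transitions in one direction have the same label, so
a labelling is given by the labels `L` of the directions. -/
def cube {A : Type u} (n : ℕ) (L : Fin n → A) : HDA.{u, 0} A where
  Q := Q n
  face := face
  cubical := cubical
  init := ⟨fun _ => .idle, by simp [busy]⟩
  label q := L (dir q 0)
  label_face q i := by rw [dir_face, dir_face]

/-- The unique cell of highest dimension of the bulk. -/
def top {A : Type u} {n : ℕ} {L : Fin n → A} : (cube n L).Q n :=
  ⟨fun _ => .busy, by simp [busy]⟩

end Bulk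

/-! ### Sculptures -/

/-- A sculpture: a higher dimensional automaton `H` together with a bulk of dimension `n` and an
embedding (an injective morphism) of `H` into the bulk. -/
structure Sculpture (A : Type u) where
  H : HDA.{u, v} A
  n : ℕ
  L : Fin n → A
  em : HDA.Hom H (Bulk.cube n L)
  injective : ∀ k : ℕ, Function.Injective (em.toFun : H.Q k → (Bulk.cube n L).Q k)

namespace Sculpture

variable {A : Type u}

/-- The bulk of a sculpture. -/
abbrev B (X : Sculpture.{u, v} A) : HDA.{u, 0} A := Bulk.cube X.n X.L

/-- A sculpture is simplistic if its embedding does not land in one of the smaller bulks that are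
given by a face `s_i(q_n)` of the bulk cell `q_n`. -/
def IsSimplistic (X : Sculpture.{u, v} A) : Prop :=
  ¬ ∃ (i : ℕ) (p : X.B.Cell), X.B.IsFace .src i ⟨X.n, Bulk.top⟩ p ∧
    ∀ (k : ℕ) (q : X.H.Q k), ∃ c : HDA.Chain p.1 k, c.apply X.B p.2 = X.em.toFun q

end Sculpture

/-! ### ST-structures -/

/-- Events, a set of pairs of finite sets of events, and a labelling. -/
structure STData (A : Type u) where
  Ev : Type w
  confs : Set (Finset Ev × Finset Ev)
  label : Ev → A

namespace STData

variable {A : Type u}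

/-- ST-structures: the pairs are ST-configurations, and what is started can terminate. -/
def IsSTStructure (X : STData.{u, w} A) : Prop :=
  (∀ c ∈ X.confs, c.2 ⊆ c.1) ∧ ∀ c ∈ X.confs, (c.1, c.1) ∈ X.confs

/-- Isomorphism of ST-structures: a bijection of the events that preserves the labels and the
ST-configurations, in both directions. -/
def Iso (X : STData.{u, v} A) (Y : STData.{u, w} A) : Prop :=
  ∃ f : X.Ev ≃ Y.Ev, (∀ e, Y.label (f e) = X.label e) ∧
    ∀ S T : Finset X.Ev,
      (S, T) ∈ X.confs ↔ (S.map f.toEmbedding, T.map f.toEmbedding) ∈ Y.confs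

/-- The event `e` occurs in some configuration. -/
def Occurs (X : STData.{u, w} A) (e : X.Ev) : Prop := ∃ c ∈ X.confs, e ∈ c.1 ∨ e ∈ c.2

/-- The same configurations, over the set of the events that occur in them. -/
def occurring (X : STData.{u, w} A) : STData.{u, w} A where
  Ev := {e : X.Ev // X.Occurs e}
  confs := {c | (c.1.map (.subtype _), c.2.map (.subtype _)) ∈ X.confs}
  label e := X.label e

end STData

/-! ### The path-based translation -/

open Classical in
/-- `PathConf cls π c`: the pair `c` of sets of events is associated with the rooted path `π`, when
`cls` maps a transition to its event. -/
inductive PathConf {A : Type u} {H : HDA.{u, v} A} {Ev : Type w} (cls : H.Q 1 → Ev) :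
    {x : H.Cell} → H.RPath x → Finset Ev × Finset Ev → Prop
  /-- The minimal rooted path. -/
  | init : PathConf cls .nil (∅, ∅)
  /-- A path `π` to a transition `q`, homotopic to a path `πs` followed by an s-step to `q`. -/
  | start {x : H.Cell} {q : H.Q 1} {π : H.RPath ⟨1, q⟩} {πs : H.RPath x} {i : ℕ}
      (h : H.IsFace .src i ⟨1, q⟩ x) (hom : H.Homotopic (πs.snoc (.up i h)) π)
      {c : Finset Ev × Finset Ev} (hc : PathConf cls πs c) :
      PathConf cls π (c.1 ∪ {cls q}, c.2)
  /-- A path to a transition `q` followed by a t-step. -/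
  | terminate {x : H.Cell} {q : H.Q 1} {π : H.RPath ⟨1, q⟩} {i : ℕ}
      (h : H.IsFace .tgt i ⟨1, q⟩ x)
      {c : Finset Ev × Finset Ev} (hc : PathConf cls π c) :
      PathConf cls (π.snoc (.down i h)) (c.1, c.2 ∪ {cls q})
  /-- A path `π` to a cell `q` of dimension at least two, homotopic to `πi` and to `πj` each followed
  by an s-step to `q`, for two different s-maps. -/
  | higher {x y : H.Cell} {m : ℕ} {q : H.Q (m + 2)} {π : H.RPath ⟨m + 2, q⟩}
      {πi : H.RPath x} {πj : H.RPath y} {i j : ℕ} (hij : i ≠ j)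
      (hi : H.IsFace .src i ⟨m + 2, q⟩ x) (hj : H.IsFace .src j ⟨m + 2, q⟩ y)
      (homi : H.Homotopic (πi.snoc (.up i hi)) π) (homj : H.Homotopic (πj.snoc (.up j hj)) π)
      {c d : Finset Ev × Finset Ev} (hc : PathConf cls πi c) (hd : PathConf cls πj d) :
      PathConf cls π (c.1 ∪ d.1, c.2 ∪ d.2)

namespace Sculpture

variable {A : Type u}

/-- Two transitions of the sculpture are equivalent if they are so in the bulk. -/
def eventEquiv (X : Sculpture.{u, v} A) : Setoid (X.H.Q 1) :=
  X.B.eventEquiv.comap X.em.toFun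

/-- The path-based translation; the events are the classes of transitions of the sculpture under the
equivalence that comes from the bulk. -/
def pathST (X : Sculpture.{u, v} A) : STData.{u, v} A where
  Ev := Quotient X.eventEquiv
  confs := {c | ∃ (x : X.H.Cell) (π : X.H.RPath x), PathConf (Quotient.mk X.eventEquiv) π c}
  label := Quotient.lift X.H.label fun q q' h => by
    rw [← X.em.map_label q, ← X.em.map_label q']
    exact HDA.label_eq_of_eventEquiv h

/-- The path-based translation, where all equivalence classes of transitions of the bulk are taken as
events, also those that contain no transition of the sculpture. -/
def pathSTBulk (X : Sculpture.{u, v} A) : STData.{u, 0} A where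
  Ev := Quotient X.B.eventEquiv
  confs := {c | ∃ (x : X.H.Cell) (π : X.H.RPath x),
    PathConf (fun q => Quotient.mk X.B.eventEquiv (X.em.toFun q)) π c}
  label := Quotient.lift X.B.label fun _ _ h => HDA.label_eq_of_eventEquiv h

end Sculpture

/-! ### The translation through chains of face maps -/

/-- One face map applied to an ST-configuration over the listing `0, …, n - 1` of the events: the event
`e` with index `i` in the listing of the executing events is un-started (`s`) or terminated (`t`).
(An index out of range, which does not occur for a correct chain, changes nothing.) -/
def confFace {n : ℕ} (a : Side) (i : ℕ) (c : Finset (Fin n) × Finset (Fin n)) :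
    Finset (Fin n) × Finset (Fin n) :=
  match ((c.1 \ c.2).sort (· ≤ ·))[i]?, a with
  | some e, .src => (c.1.erase e, c.2)
  | some e, .tgt => (c.1, insert e c.2)
  | none, _ => c

/-- A chain applied to an ST-configuration. -/
def HDA.Chain.applyConf {n k : ℕ} : {m : ℕ} → HDA.Chain k m →
    Finset (Fin n) × Finset (Fin n) → Finset (Fin n) × Finset (Fin n)
  | _, .nil, c => c
  | _, .comp a i α, c => confFace a i (α.applyConf c)

/-- The translation that reads the configurations of the cells off the chains from the bulk cell; the
`n` directions of the bulk are the events, in their order. -/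
def Sculpture.chainST {A : Type u} (X : Sculpture.{u, v} A) : STData.{u, 0} A where
  Ev := Fin X.n
  confs := {c | ∃ (k : ℕ) (q : X.H.Q k) (α : HDA.Chain X.n k),
    α.apply X.B Bulk.top = X.em.toFun q ∧ c = α.applyConf (Finset.univ, ∅)}
  label := X.L

/-!
Every cell of the cube determines a configuration, `Bulk.conf`: the events that are not idle in it and
those that are finished. All three translations assign to a cell `x` of the sculpture the
configuration of the image of `x` in the bulk, and to nothing else.

For chains this holds because a face map acts on the phases of a cell as it acts on configurations
(`Bulk.confFace_conf`), and because every cell of the cube is reached from the top cell by some chain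
(`Bulk.exists_chain`).

For paths, two transitions of the cube are equivalent exactly if they have the same direction
(`Bulk.eventEquiv_iff`), so the events are directions. The rules then preserve the invariant that the
pair associated with a path is the configuration of its last cell
(`Sculpture.map_eq_conf_of_pathConf`). It remains to see that the rules associate a pair with every
rooted path (`HDA.RPath.exists_pathConf`). For this, a path to a cell can be deformed into one of the
same length that enters the cell through any prescribed s-face (`HDA.RPath.exists_homotopic_up`);
hence an induction on the length applies, even for paths that end with a t-step.

The last fact also shows that every event started in some cell is the direction of a transition of the
sculpture, which identifies the events of the path-based translation with those that occur
(`Sculpture.chainST_occurs_iff`). If an event does not occur, it is idle in all cells and the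
sculpture lies in an s-face of the bulk cell, which a simplistic sculpture excludes.
-/

namespace HDA

variable {A : Type u} {H : HDA.{u, v} A}

/-! ### Faces of faces -/

theorem IsFace.unique {a : Side} {i : ℕ} {y x x' : H.Cell} (h : H.IsFace a i y x)
    (h' : H.IsFace a i y x') : x = x' := by
  obtain ⟨i, q⟩ := h
  generalize hi : (i : ℕ) = i' at h'
  cases h' with
  | mk j _ =>
    obtain rfl : i = j := Fin.ext hi
    rfl

/-- Two faces of one cell, of different indices, have a common face. -/
theorem IsFace.exists_common {a b : Side} {i j : ℕ} (hij : i ≤ j) {y z x : H.Cell}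
    (hz : H.IsFace b (j + 1) y z) (hx : H.IsFace a i y x) :
    ∃ w, H.IsFace a i z w ∧ H.IsFace b j x w := by
  generalize hj : j + 1 = j' at hz
  obtain @⟨n, i, q⟩ := hx
  cases hz with
  | mk j' _ =>
    obtain _ | n := n
    · omega
    obtain ⟨j', rfl⟩ : ∃ k : Fin (n + 1), j' = k.succ :=
      ⟨⟨j, by omega⟩, Fin.ext hj.symm⟩
    obtain ⟨i, rfl⟩ : ∃ k : Fin (n + 1), i = k.castSucc := ⟨⟨i, by omega⟩, rfl⟩
    obtain rfl : j = j' := by simpa using hj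
    refine ⟨_, .mk a i _, ?_⟩
    rw [H.cubical a b i j' hij q]
    exact .mk b j' _

/-- A face of a face, the first face map having the larger index, with the order of the two face
maps exchanged. -/
theorem IsFace.exchange_of_le {a b : Side} {i j : ℕ} (hij : i ≤ j) {z y x : H.Cell}
    (hy : H.IsFace b (j + 1) z y) (hx : H.IsFace a i y x) :
    ∃ w, H.IsFace a i z w ∧ H.IsFace b j w x := by
  generalize hj : j + 1 = j' at hy
  obtain @⟨n, i, q⟩ := hx
  generalize hy' : (⟨_, q⟩ : H.Cell) = y' at hy
  cases hy with
  | mk j' p =>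
    cases hy'
    obtain ⟨j', rfl⟩ : ∃ k : Fin (n + 1), j' = k.succ :=
      ⟨⟨j, by omega⟩, Fin.ext hj.symm⟩
    obtain rfl : j = j' := by simpa using hj
    refine ⟨_, .mk a i.castSucc _, ?_⟩
    rw [H.cubical a b i j' hij p]
    exact .mk b j' _

/-- A face of a face, the second face map having at least the index of the first, with the order of
the two face maps exchanged. -/
theorem IsFace.exchange_of_ge {a b : Side} {i j : ℕ} (hij : j ≤ i) {z y x : H.Cell}
    (hy : H.IsFace b j z y) (hx : H.IsFace a i y x) :
    ∃ w, H.IsFace a (i + 1) z w ∧ H.IsFace b j w x := by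
  obtain @⟨n, i, q⟩ := hx
  generalize hy' : (⟨_, q⟩ : H.Cell) = y' at hy
  cases hy with
  | mk j' p =>
    cases hy'
    obtain ⟨j', rfl⟩ : ∃ k : Fin (n + 1), j' = k.castSucc := ⟨⟨j', by omega⟩, rfl⟩
    refine ⟨_, .mk a i.succ _, ?_⟩
    rw [← H.cubical b a j' i hij p]
    exact .mk b j' _

/-! ### Rooted paths up to homotopy -/

/-- The number of steps of a rooted path. -/
def RPath.length : {x : H.Cell} → H.RPath x → ℕ
  | _, .nil => 0
  | _, .snoc p _ => p.length + 1

theorem Homotopic.snoc {x y : H.Cell} {p p' : H.RPath x} (h : H.Homotopic p p')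
    (st : H.Step x y) : H.Homotopic (p.snoc st) (p'.snoc st) := by
  induction h with
  | rel _ _ h => exact .rel _ _ (.snoc st h)
  | refl _ => exact .refl _
  | symm _ _ _ ih => exact .symm _ _ ih
  | trans _ _ _ _ _ ih₁ ih₂ => exact .trans _ _ _ ih₁ ih₂

/-- A rooted path to a cell can be deformed, without changing its length, into one that enters the
cell by any prescribed s-step: such a step exists at the end of the path one step earlier, and it is
moved past the last step by one of the cubical laws. -/
theorem RPath.exists_homotopic_up {y : H.Cell} (π : H.RPath y) {x : H.Cell} {i : ℕ}
    (h : H.IsFace .src i y x) :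
    ∃ π' : H.RPath x, H.Homotopic (π'.snoc (.up i h)) π ∧ π'.length + 1 = π.length := by
  induction π generalizing x i with
  | nil => cases h
  | @snoc z y p st ih =>
    cases st with
    | up j hj =>
      rcases lt_trichotomy i j with hij | rfl | hij
      · obtain ⟨j, rfl⟩ : ∃ j', j = j' + 1 := ⟨j - 1, by omega⟩
        have hij' : i ≤ j := by omega
        obtain ⟨w, hw₁, hw₂⟩ := IsFace.exists_common hij' hj h
        obtain ⟨p', hp', hl⟩ := ih hw₁
        exact ⟨p'.snoc (.up j hw₂), .trans _ _ _
          (.symm _ _ (.rel _ _ (.ss p' i j hij' hw₁ hj hw₂ h))) (hp'.snoc _),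
          congrArg (· + 1) hl⟩
      · obtain rfl := h.unique hj
        exact ⟨p, .refl _, rfl⟩
      · obtain ⟨i, rfl⟩ : ∃ i', i = i' + 1 := ⟨i - 1, by omega⟩
        have hij' : j ≤ i := by omega
        obtain ⟨w, hw₁, hw₂⟩ := IsFace.exists_common hij' h hj
        obtain ⟨p', hp', hl⟩ := ih hw₂
        exact ⟨p'.snoc (.up j hw₁), .trans _ _ _
          (.rel _ _ (.ss p' j i hij' hw₁ h hw₂ hj)) (hp'.snoc _), congrArg (· + 1) hl⟩
    | down j hj =>
      rcases lt_or_ge i j with hij | hij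
      · obtain ⟨j, rfl⟩ : ∃ j', j = j' + 1 := ⟨j - 1, by omega⟩
        have hij' : i ≤ j := by omega
        obtain ⟨w, hw₁, hw₂⟩ := IsFace.exchange_of_le hij' hj h
        obtain ⟨p', hp', hl⟩ := ih hw₁
        exact ⟨p'.snoc (.down j hw₂), .trans _ _ _
          (.symm _ _ (.rel _ _ (.st p' i j hij' hw₁ hj hw₂ h))) (hp'.snoc _),
          congrArg (· + 1) hl⟩
      · obtain ⟨w, hw₁, hw₂⟩ := IsFace.exchange_of_ge hij hj h
        obtain ⟨p', hp', hl⟩ := ih hw₁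
        exact ⟨p'.snoc (.down j hw₂), .trans _ _ _
          (.symm _ _ (.rel _ _ (.ts p' j i hij hw₁ hj hw₂ h))) (hp'.snoc _),
          congrArg (· + 1) hl⟩

/-- The path-based rules associate at least one pair with each rooted path, by induction on the
length of the path. -/
theorem RPath.exists_pathConf {Ev : Type w} (cls : H.Q 1 → Ev) {x : H.Cell} (π : H.RPath x) :
    ∃ c, PathConf cls π c := by
  induction hl : π.length using Nat.strong_induction_on generalizing x with
  | _ l ih =>
    subst hl
    obtain ⟨k, q⟩ := x
    obtain _ | _ | m := k
    · cases π with
      | nil => exact ⟨_, .init⟩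
      | snoc p st =>
        cases st with
        | up i h => cases h
        | down i h =>
          obtain ⟨c, hc⟩ := ih p.length (Nat.lt_succ_self _) p rfl
          cases h with
          | mk i q => exact ⟨_, .terminate (.mk _ i q) hc⟩
    · obtain ⟨p, hp, hl⟩ := π.exists_homotopic_up (.mk .src 0 q)
      obtain ⟨c, hc⟩ := ih p.length (by omega) p rfl
      exact ⟨_, .start _ hp hc⟩
    · obtain ⟨p, hp, hl⟩ := π.exists_homotopic_up (.mk .src 0 q)
      obtain ⟨p', hp', hl'⟩ := π.exists_homotopic_up (.mk .src 1 q)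
      obtain ⟨c, hc⟩ := ih p.length (by omega) p rfl
      obtain ⟨c', hc'⟩ := ih p'.length (by omega) p' rfl
      exact ⟨_, .higher (by simp) _ _ hp hp' hc hc'⟩

end HDA

namespace Bulk

variable {n : ℕ}

/-! ### Cells of the cube -/

theorem mem_busy {x : Fin n → Phase} {e : Fin n} : e ∈ busy x ↔ x e = .busy := by
  simp [busy]

theorem exists_dir_eq {k : ℕ} (q : Q n k) {e : Fin n} (h : q.1 e = .busy) :
    ∃ i, dir q i = e := by
  have : e ∈ Set.range ((busy q.1).orderEmbOfFin q.2) := by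
    rw [Finset.range_orderEmbOfFin]
    exact mem_busy.mpr h
  exact this

/-- In a transition of the cube, only the direction of the transition is busy. -/
theorem eq_dir_of_busy (q : Q n 1) {e : Fin n} (h : q.1 e = .busy) : e = dir q 0 := by
  obtain ⟨i, rfl⟩ := exists_dir_eq q h
  rw [Subsingleton.elim i 0]

/-- The cell that extends `q` in the direction `d`. -/
def extend {k : ℕ} (q : Q n k) (d : Fin n) (h : q.1 d ≠ .busy) : Q n (k + 1) :=
  ⟨Function.update q.1 d .busy, by
    have : busy (Function.update q.1 d .busy) = insert d (busy q.1) := by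
      ext e
      rcases eq_or_ne e d with rfl | he
      · simp [mem_busy]
      · simp [mem_busy, he]
    rw [this, Finset.card_insert_of_notMem (by rwa [mem_busy]), q.2]⟩

theorem exists_face_extend {k : ℕ} (q : Q n k) (d : Fin n) (h : q.1 d ≠ .busy) :
    ∃ i, ∀ a : Side, (face a i (extend q d h)).1 = Function.update q.1 d a.phase := by
  obtain ⟨i, hi⟩ := exists_dir_eq (extend q d h) (e := d) (by simp [extend])
  refine ⟨i, fun a => ?_⟩
  change Function.update (extend q d h).1 (dir (extend q d h) i) a.phase = _
  rw [hi]
  simp [extend]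

theorem exists_phase_eq {p : Phase} (h : p ≠ .busy) : ∃ a : Side, a.phase = p := by
  cases p with
  | idle => exact ⟨.src, rfl⟩
  | busy => exact absurd rfl h
  | finished => exact ⟨.tgt, rfl⟩

/-- The cells of the subcube spanned by `p` are those obtained from `p` by chains of face maps. -/
theorem exists_chain {A : Type u} (L : Fin n → A) {k m : ℕ} (p : Q n k) (q : Q n m)
    (h : ∀ d, p.1 d = .busy ∨ p.1 d = q.1 d) :
    ∃ c : HDA.Chain k m, c.apply (cube n L) p = q := by
  -- Induction on the number of coordinates that have to be changed.
  induction hN : (Finset.univ.filter fun d => p.1 d ≠ q.1 d).card generalizing m with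
  | zero =>
    have hpq : p.1 = q.1 := by
      funext d
      by_contra hd
      have := Finset.card_eq_zero.mp hN
      exact Finset.notMem_empty d (this ▸ Finset.mem_filter.mpr ⟨Finset.mem_univ d, hd⟩)
    obtain ⟨x, rfl⟩ := p
    obtain ⟨y, rfl⟩ := q
    obtain rfl : x = y := hpq
    exact ⟨.nil, rfl⟩
  | succ N ih =>
    obtain ⟨d, hd⟩ := Finset.card_pos.mp (by rw [hN]; exact N.succ_pos)
    have hd' : p.1 d ≠ q.1 d := (Finset.mem_filter.mp hd).2
    have hb : p.1 d = .busy := (h d).resolve_right hd'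
    have hq : q.1 d ≠ .busy := fun h' => hd' (hb.trans h'.symm)
    obtain ⟨c, hc⟩ := ih (extend q d hq) (fun e => by
        rcases eq_or_ne e d with rfl | he
        · exact .inl hb
        · simpa [extend, he] using h e) (by
      have : (Finset.univ.filter fun e => p.1 e ≠ (extend q d hq).1 e) =
          (Finset.univ.filter fun e => p.1 e ≠ q.1 e).erase d := by
        ext e
        rw [Finset.mem_filter, Finset.mem_erase, Finset.mem_filter]
        rcases eq_or_ne e d with rfl | he
        · simp [extend, hb]
        · simp [extend, he]
      rw [this, Finset.card_erase_of_mem hd, hN, Nat.add_sub_cancel])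
    obtain ⟨i, hi⟩ := exists_face_extend q d hq
    obtain ⟨a, ha⟩ := exists_phase_eq hq
    refine ⟨.comp a i c, ?_⟩
    change face a i (c.apply (cube n L) p) = q
    rw [hc]
    apply Subtype.ext
    rw [hi, ha, Function.update_eq_self]

/-! ### Parallel transitions of the cube -/

theorem dir_eq_of_parallel {A : Type u} {L : Fin n → A} {q q' : Q n 1}
    (h : (cube n L).Parallel q q') : dir q 0 = dir q' 0 := by
  obtain ⟨r, i, a, b, rfl, rfl⟩ := h
  exact (dir_face a i r 0).trans (dir_face b i r 0).symm

/-- Two transitions of the cube are equivalent if and only if they have the same direction. The other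
coordinates are changed one at a time, each time across a square. -/
theorem eventEquiv_iff {A : Type u} {L : Fin n → A} {q q' : Q n 1} :
    (cube n L).eventEquiv.r q q' ↔ dir q 0 = dir q' 0 := by
  constructor
  · intro h
    change Relation.ReflTransGen (cube n L).Parallel q q' at h
    induction h with
    | refl => rfl
    | tail _ h ih => exact ih.trans (dir_eq_of_parallel h)
  · intro h
    change Relation.ReflTransGen (cube n L).Parallel q q'
    induction hN : (Finset.univ.filter fun d => q.1 d ≠ q'.1 d).card generalizing q with
    | zero =>
      have hpq : q = q' := by
        apply Subtype.ext
        funext d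
        by_contra hd
        have := Finset.card_eq_zero.mp hN
        exact Finset.notMem_empty d (this ▸ Finset.mem_filter.mpr ⟨Finset.mem_univ d, hd⟩)
      exact hpq ▸ .refl
    | succ N ih =>
      obtain ⟨d, hd⟩ := Finset.card_pos.mp (by rw [hN]; exact N.succ_pos)
      have hd' : q.1 d ≠ q'.1 d := (Finset.mem_filter.mp hd).2
      have hq0 : q.1 (dir q 0) = .busy := mem_busy.mp (dir_mem q 0)
      have hq0' : q'.1 (dir q' 0) = .busy := mem_busy.mp (dir_mem q' 0)
      have hq : q.1 d ≠ .busy := fun h' => hd' <| by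
        rw [eq_dir_of_busy q h', hq0, h, hq0']
      have hq' : q'.1 d ≠ .busy := fun h' => hd' <| by
        rw [eq_dir_of_busy q' h', hq0', ← h, hq0]
      obtain ⟨i, hi⟩ := exists_face_extend q d hq
      obtain ⟨a, ha⟩ := exists_phase_eq hq
      obtain ⟨b, hb⟩ := exists_phase_eq hq'
      have hpar : (cube n L).Parallel q (face b i (extend q d hq)) :=
        ⟨extend q d hq, i, a, b, Subtype.ext (by
          change (face a i (extend q d hq)).1 = q.1
          rw [hi, ha, Function.update_eq_self]), rfl⟩
      refine .head hpar (ih ((dir_eq_of_parallel hpar).symm.trans h) ?_)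
      have : (Finset.univ.filter fun e => (face b i (extend q d hq)).1 e ≠ q'.1 e) =
          (Finset.univ.filter fun e => q.1 e ≠ q'.1 e).erase d := by
        rw [hi, hb]
        ext e
        rcases eq_or_ne e d with rfl | he
        · simp
        · simp [he]
      rw [this, Finset.card_erase_of_mem hd, hN, Nat.add_sub_cancel]

/-- The transition in direction `e` that starts in the initial corner. -/
def initTransition (e : Fin n) : Q n 1 :=
  extend ⟨fun _ => .idle, by simp [busy]⟩ e (by simp)

theorem dir_initTransition (e : Fin n) : dir (initTransition e) 0 = e :=
  (eq_dir_of_busy _ (by simp [initTransition, extend])).symm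

/-- The events of the cube are its directions. -/
def eventEquivFin {A : Type u} (L : Fin n → A) : Quotient (cube n L).eventEquiv ≃ Fin n where
  toFun := Quotient.lift (fun q : Q n 1 => dir q 0) fun _ _ h => eventEquiv_iff.mp h
  invFun e := Quotient.mk (cube n L).eventEquiv (initTransition e)
  left_inv := by
    rintro ⟨q⟩
    exact Quotient.sound (eventEquiv_iff.mpr (dir_initTransition (dir q 0)))
  right_inv e := dir_initTransition e

/-! ### The configuration of a cell of the cube -/

/-- The configuration of a cell of the cube: the events that have started, and those that have
terminated. -/
def conf (x : Fin n → Phase) : Finset (Fin n) × Finset (Fin n) :=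
  (Finset.univ.filter fun e => x e ≠ .idle, Finset.univ.filter fun e => x e = .finished)

theorem mem_conf_fst {x : Fin n → Phase} {e : Fin n} : e ∈ (conf x).1 ↔ x e ≠ .idle := by
  simp [conf]

theorem mem_conf_snd {x : Fin n → Phase} {e : Fin n} : e ∈ (conf x).2 ↔ x e = .finished := by
  simp [conf]

theorem conf_sdiff (x : Fin n → Phase) : (conf x).1 \ (conf x).2 = busy x := by
  ext e
  rw [Finset.mem_sdiff, mem_conf_fst, mem_conf_snd, mem_busy]
  cases x e <;> simp

theorem conf_update_src (x : Fin n → Phase) {e : Fin n} (h : x e = .busy) :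
    conf (Function.update x e Side.src.phase) = ((conf x).1.erase e, (conf x).2) := by
  apply Prod.ext <;> ext d <;> rcases eq_or_ne d e with rfl | hd <;>
    simp [mem_conf_fst, mem_conf_snd, Side.phase, *]

theorem conf_update_tgt (x : Fin n → Phase) {e : Fin n} (h : x e = .busy) :
    conf (Function.update x e Side.tgt.phase) = ((conf x).1, insert e (conf x).2) := by
  apply Prod.ext <;> ext d <;> rcases eq_or_ne d e with rfl | hd <;>
    simp [mem_conf_fst, mem_conf_snd, Side.phase, *]

theorem confFace_conf (a : Side) {k : ℕ} (i : Fin (k + 1)) (q : Q n (k + 1)) :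
    confFace a i (conf q.1) = conf (face a i q).1 := by
  have hs : (((conf q.1).1 \ (conf q.1).2).sort (· ≤ ·))[(i : ℕ)]? = some (dir q i) := by
    rw [conf_sdiff, dir, Finset.orderEmbOfFin_apply]
    simp
  have hb : q.1 (dir q i) = .busy := mem_busy.mp (dir_mem q i)
  change _ = conf (Function.update q.1 (dir q i) a.phase)
  unfold confFace
  rw [hs]
  cases a
  · exact (conf_update_src _ hb).symm
  · exact (conf_update_tgt _ hb).symm

theorem applyConf_conf {A : Type u} (L : Fin n → A) {k m : ℕ} (c : HDA.Chain k m) (q : Q n k) :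
    c.applyConf (conf q.1) = conf (c.apply (cube n L) q : Q n m).1 := by
  induction c with
  | nil => rfl
  | comp a i c ih =>
    change confFace a i (c.applyConf _) = conf (face a i (c.apply (cube n L) q)).1
    rw [ih]
    exact confFace_conf a i _

theorem conf_top : conf (fun _ : Fin n => Phase.busy) = (Finset.univ, ∅) := by
  simp [conf]

end Bulk

namespace Sculpture

variable {A : Type u} (X : Sculpture.{u, v} A)

/-! ### The configuration of a cell of a sculpture -/

/-- The phases of the events in a cell of the sculpture. -/
def phase (x : X.H.Cell) : Fin X.n → Phase := Subtype.val (X.em.toFun x.2 : Bulk.Q X.n x.1)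

/-- The direction of a transition of the sculpture. -/
def dir (q : X.H.Q 1) : Fin X.n := Bulk.dir (X.em.toFun q : Bulk.Q X.n 1) 0

theorem phase_dir (q : X.H.Q 1) : X.phase ⟨1, q⟩ (X.dir q) = .busy :=
  Bulk.mem_busy.mp (Bulk.dir_mem _ _)

theorem phase_face (a : Side) {k : ℕ} (i : Fin (k + 1)) (q : X.H.Q (k + 1)) :
    X.phase ⟨k, X.H.face a i q⟩ = Function.update (X.phase ⟨k + 1, q⟩)
      (Bulk.dir (X.em.toFun q : Bulk.Q X.n (k + 1)) i) a.phase := by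
  unfold phase
  exact congrArg Subtype.val (X.em.map_face a i q).symm

/-- The chain translation assigns to each cell exactly one configuration, that of its image in the
bulk. -/
theorem mem_chainST_confs {c : Finset (Fin X.n) × Finset (Fin X.n)} :
    c ∈ X.chainST.confs ↔ ∃ x : X.H.Cell, c = Bulk.conf (X.phase x) := by
  constructor
  · rintro ⟨k, q, α, hα, rfl⟩
    refine ⟨⟨k, q⟩, ?_⟩
    have h := Bulk.applyConf_conf X.L α (Bulk.top (L := X.L))
    rw [hα] at h
    rw [← Bulk.conf_top]
    exact h
  · rintro ⟨⟨k, q⟩, rfl⟩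
    obtain ⟨α, hα⟩ := Bulk.exists_chain X.L Bulk.top (X.em.toFun q) fun _ => .inl rfl
    refine ⟨k, q, α, hα, ?_⟩
    have h := Bulk.applyConf_conf X.L α (Bulk.top (L := X.L))
    rw [hα] at h
    rw [← Bulk.conf_top]
    exact h.symm

/-- Started events can all terminate: t-maps lead from any cell to a cell of dimension `0`. -/
theorem exists_conf_eq_diag (x : X.H.Cell) :
    ∃ y : X.H.Cell, Bulk.conf (X.phase y) =
      ((Bulk.conf (X.phase x)).1, (Bulk.conf (X.phase x)).1) := by
  obtain ⟨k, q⟩ := x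
  induction k with
  | zero =>
    refine ⟨⟨0, q⟩, Prod.ext rfl ?_⟩
    have h : Bulk.busy (X.phase ⟨0, q⟩) = ∅ :=
      Finset.card_eq_zero.mp (X.em.toFun q : Bulk.Q X.n 0).2
    ext e
    have he : X.phase ⟨0, q⟩ e ≠ .busy := fun h' =>
      Finset.notMem_empty e (h ▸ Bulk.mem_busy.mpr h')
    rw [Bulk.mem_conf_fst, Bulk.mem_conf_snd]
    cases hp : X.phase ⟨0, q⟩ e <;> simp_all
  | succ k ih =>
    obtain ⟨y, hy⟩ := ih (X.H.face .tgt 0 q)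
    refine ⟨y, ?_⟩
    rw [hy, phase_face, Bulk.conf_update_tgt]
    exact Bulk.mem_busy.mp (Bulk.dir_mem _ _)

theorem chainST_isSTStructure : X.chainST.IsSTStructure := by
  constructor
  · intro c hc
    obtain ⟨x, rfl⟩ := X.mem_chainST_confs.mp hc
    intro e he
    have he' := Bulk.mem_conf_snd.mp he
    exact Bulk.mem_conf_fst.mpr (by simp [he'])
  · intro c hc
    obtain ⟨x, rfl⟩ := X.mem_chainST_confs.mp hc
    obtain ⟨y, hy⟩ := X.exists_conf_eq_diag x
    exact X.mem_chainST_confs.mpr ⟨y, hy.symm⟩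

theorem chainST_occurs {e : Fin X.n} :
    X.chainST.Occurs e ↔ ∃ x : X.H.Cell, e ∈ (Bulk.conf (X.phase x)).1 := by
  constructor
  · rintro ⟨c, hc, he⟩
    have he' : e ∈ c.1 := he.elim id fun h => X.chainST_isSTStructure.1 c hc h
    obtain ⟨x, rfl⟩ := X.mem_chainST_confs.mp hc
    exact ⟨x, he'⟩
  · rintro ⟨x, he⟩
    exact ⟨_, X.mem_chainST_confs.mpr ⟨x, rfl⟩, .inl he⟩

/-! ### Path-based configurations -/

theorem conf_face_src {k i : ℕ} {q : X.H.Q (k + 1)} {x : X.H.Cell}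
    (h : X.H.IsFace .src i ⟨k + 1, q⟩ x) : ∃ hi : i < k + 1,
    Bulk.conf (X.phase x) = ((Bulk.conf (X.phase ⟨k + 1, q⟩)).1.erase
      (Bulk.dir (X.em.toFun q : Bulk.Q X.n (k + 1)) ⟨i, hi⟩),
      (Bulk.conf (X.phase ⟨k + 1, q⟩)).2) := by
  cases h with
  | mk i q =>
    refine ⟨i.2, ?_⟩
    rw [phase_face, Bulk.conf_update_src]
    exact Bulk.mem_busy.mp (Bulk.dir_mem _ _)

theorem conf_face_tgt {k i : ℕ} {q : X.H.Q (k + 1)} {x : X.H.Cell}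
    (h : X.H.IsFace .tgt i ⟨k + 1, q⟩ x) : ∃ hi : i < k + 1,
    Bulk.conf (X.phase x) = ((Bulk.conf (X.phase ⟨k + 1, q⟩)).1,
      insert (Bulk.dir (X.em.toFun q : Bulk.Q X.n (k + 1)) ⟨i, hi⟩)
        (Bulk.conf (X.phase ⟨k + 1, q⟩)).2) := by
  cases h with
  | mk i q =>
    refine ⟨i.2, ?_⟩
    rw [phase_face, Bulk.conf_update_tgt]
    exact Bulk.mem_busy.mp (Bulk.dir_mem _ _)

theorem conf_init : Bulk.conf (X.phase ⟨0, X.H.init⟩) = (∅, ∅) := by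
  have h : X.phase ⟨0, X.H.init⟩ = fun _ => .idle := congrArg Subtype.val X.em.map_init
  rw [h]
  simp [Bulk.conf]

variable {X} {Ev : Type w} {cls : X.H.Q 1 → Ev}

/-- Whenever the events are named by directions of the bulk, every pair that the path-based rules
associate with a path is the configuration of the cell in which the path ends. -/
theorem map_eq_conf_of_pathConf (g : Ev ↪ Fin X.n) (hg : ∀ q, g (cls q) = X.dir q)
    {x : X.H.Cell} {π : X.H.RPath x} {c : Finset Ev × Finset Ev} (h : PathConf cls π c) :
    (c.1.map g, c.2.map g) = Bulk.conf (X.phase x) := by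
  classical
  induction h with
  | init => simp [conf_init]
  | @start x q π πs i h hom c hc ih =>
    obtain ⟨hi, hx⟩ := X.conf_face_src h
    obtain rfl : i = 0 := by omega
    rw [hx, Prod.mk.injEq] at ih
    refine Prod.ext ?_ ih.2
    simp only [Finset.map_union, Finset.map_singleton, hg, ih.1]
    change _ ∪ {Bulk.dir _ 0} = _
    rw [Finset.union_comm]
    refine Finset.insert_erase (Bulk.mem_conf_fst.mpr ?_)
    exact fun h' => absurd ((X.phase_dir q).symm.trans h') (by simp)
  | @terminate x q π i h c hc ih =>
    obtain ⟨hi, hx⟩ := X.conf_face_tgt h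
    obtain rfl : i = 0 := by omega
    rw [hx, ← ih]
    refine Prod.ext rfl ?_
    simp only [Finset.map_union, Finset.map_singleton, hg]
    rw [Finset.union_comm]
    rfl
  | @higher x y m q π πi πj i j hij hi hj homi homj c d hc hd ihc ihd =>
    obtain ⟨hi', hx⟩ := X.conf_face_src hi
    obtain ⟨hj', hy⟩ := X.conf_face_src hj
    rw [hx, Prod.mk.injEq] at ihc
    rw [hy, Prod.mk.injEq] at ihd
    -- Each of the two faces loses one event, and these two events are different.
    have hne := Bulk.dir_ne (X.em.toFun q : Bulk.Q X.n (m + 2)) (i := ⟨i, hi'⟩) (j := ⟨j, hj'⟩)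
      (by simpa using hij)
    apply Prod.ext
    · simp only [Finset.map_union, ihc.1, ihd.1]
      ext e
      simp only [Finset.mem_union, Finset.mem_erase]
      constructor
      · rintro (h | h) <;> exact h.2
      · intro h
        by_cases he : e = Bulk.dir (X.em.toFun q : Bulk.Q X.n (m + 2)) ⟨i, hi'⟩
        · exact .inr ⟨he ▸ hne, h⟩
        · exact .inl ⟨he, h⟩
    · simp only [Finset.map_union, ihc.2, ihd.2, Finset.union_self]

/-- The path-based and the chain-based configurations correspond to each other. -/
theorem exists_pathConf_iff (hX : X.H.IsReachable) (g : Ev ↪ Fin X.n)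
    (hg : ∀ q, g (cls q) = X.dir q) (S T : Finset Ev) :
    (∃ (x : X.H.Cell) (π : X.H.RPath x), PathConf cls π (S, T)) ↔
      (S.map g, T.map g) ∈ X.chainST.confs := by
  rw [mem_chainST_confs]
  constructor
  · rintro ⟨x, π, h⟩
    exact ⟨x, map_eq_conf_of_pathConf g hg h⟩
  · rintro ⟨x, hx⟩
    obtain ⟨π⟩ := hX x
    obtain ⟨⟨S', T'⟩, h⟩ := π.exists_pathConf cls
    have h' := (map_eq_conf_of_pathConf g hg h).trans hx.symm
    rw [Prod.mk.injEq, Finset.map_inj, Finset.map_inj] at h'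
    obtain ⟨rfl, rfl⟩ := h'
    exact ⟨x, π, h⟩

variable (X)

/-- An event of the path-based translation as a direction of the bulk. -/
def pathEvent : Quotient X.eventEquiv ↪ Fin X.n where
  toFun := Quotient.lift X.dir fun _ _ h => Bulk.eventEquiv_iff.mp h
  inj' := by
    rintro ⟨q⟩ ⟨q'⟩ h
    exact Quotient.sound (s := X.eventEquiv) (Bulk.eventEquiv_iff.mpr h)

theorem mem_pathST_confs (hX : X.H.IsReachable) (S T : Finset (Quotient X.eventEquiv)) :
    (S, T) ∈ X.pathST.confs ↔ (S.map X.pathEvent, T.map X.pathEvent) ∈ X.chainST.confs :=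
  exists_pathConf_iff hX X.pathEvent (fun _ => rfl) S T

theorem mem_pathSTBulk_confs (hX : X.H.IsReachable) (S T : Finset (Quotient X.B.eventEquiv)) :
    (S, T) ∈ X.pathSTBulk.confs ↔ (S.map (Bulk.eventEquivFin X.L).toEmbedding,
      T.map (Bulk.eventEquivFin X.L).toEmbedding) ∈ X.chainST.confs :=
  exists_pathConf_iff hX (Bulk.eventEquivFin X.L).toEmbedding (fun _ => rfl) S T

/-- An event occurs in a chain-based configuration if and only if it is the direction of a transition
of the sculpture: the pair that the path-based rules associate with a path to the cell in question
consists of directions of transitions. -/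
theorem chainST_occurs_iff (hX : X.H.IsReachable) {e : Fin X.n} :
    X.chainST.Occurs e ↔ e ∈ Set.range X.pathEvent := by
  rw [chainST_occurs]
  constructor
  · rintro ⟨x, hx⟩
    obtain ⟨π⟩ := hX x
    obtain ⟨c, h⟩ := π.exists_pathConf (Quotient.mk X.eventEquiv)
    rw [← map_eq_conf_of_pathConf X.pathEvent (fun _ => rfl) h] at hx
    obtain ⟨e', -, rfl⟩ := Finset.mem_map.mp hx
    exact ⟨e', rfl⟩
  · rintro ⟨⟨q⟩, rfl⟩
    refine ⟨⟨1, q⟩, Bulk.mem_conf_fst.mpr fun h => ?_⟩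
    exact absurd ((X.phase_dir q).symm.trans h) (by simp)

/-- In a simplistic sculpture all events occur: an event that is idle in every cell gives a face of the
bulk cell in which the sculpture is contained. -/
theorem chainST_occurs_of_isSimplistic (hs : X.IsSimplistic) (e : Fin X.n) :
    X.chainST.Occurs e := by
  rw [chainST_occurs]
  by_contra! hc
  apply hs
  obtain ⟨H, n, L, em, inj⟩ := X
  obtain _ | n := n
  · exact e.elim0
  obtain ⟨i, hi⟩ := Bulk.exists_dir_eq (Bulk.top (L := L)) (e := e) rfl
  refine ⟨i, _, .mk .src i Bulk.top, fun k q => Bulk.exists_chain L _ (em.toFun q) fun d => ?_⟩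
  change Function.update (fun _ : Fin (n + 1) => Phase.busy) (Bulk.dir (Bulk.top (L := L)) i)
      Side.src.phase d = _ ∨
    Function.update (fun _ : Fin (n + 1) => Phase.busy) (Bulk.dir (Bulk.top (L := L)) i)
      Side.src.phase d = _
  rw [hi]
  rcases eq_or_ne d e with rfl | hd
  · right
    rw [Function.update_self]
    by_contra h
    exact hc ⟨k, q⟩ (Bulk.mem_conf_fst.mpr fun h' => h h'.symm)
  · left
    rw [Function.update_of_ne hd]

end Sculpture

/-! ### Isomorphisms of ST-structures -/

namespace STData

variable {A : Type u} {X : STData.{u, v} A} {Y : STData.{u, w} A}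

/-- Being an ST-structure is reflected along a renaming of the events. -/
theorem IsSTStructure.of_embedding (hY : Y.IsSTStructure) (g : X.Ev ↪ Y.Ev)
    (hg : ∀ S T : Finset X.Ev, (S, T) ∈ X.confs ↔ (S.map g, T.map g) ∈ Y.confs) :
    X.IsSTStructure :=
  ⟨fun _ hc => Finset.map_subset_map.mp (hY.1 _ ((hg _ _).mp hc)),
    fun _ hc => (hg _ _).mpr (hY.2 _ ((hg _ _).mp hc))⟩

/-- A renaming of the events whose range consists of the events that occur gives an isomorphism with
the restriction to these events. -/
theorem Iso.occurring_of_embedding (g : X.Ev ↪ Y.Ev) (hl : ∀ e, Y.label (g e) = X.label e)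
    (hg : ∀ S T : Finset X.Ev, (S, T) ∈ X.confs ↔ (S.map g, T.map g) ∈ Y.confs)
    (hr : ∀ e, Y.Occurs e ↔ e ∈ Set.range g) : X.Iso Y.occurring := by
  let f : X.Ev ≃ {e // Y.Occurs e} := Equiv.ofBijective
    (fun e => ⟨g e, (hr _).mpr ⟨e, rfl⟩⟩)
    ⟨fun e e' h => g.injective (congrArg Subtype.val h), fun ⟨e, he⟩ => by
      obtain ⟨e', rfl⟩ := (hr e).mp he
      exact ⟨e', rfl⟩⟩
  have hf : f.toEmbedding.trans (.subtype _) = g := rfl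
  refine ⟨f, hl, fun S T => ?_⟩
  rw [hg, ← hf, ← Finset.map_map, ← Finset.map_map]
  rfl

/-- A renaming of the events onto all events gives an isomorphism. -/
theorem Iso.of_embedding (g : X.Ev ↪ Y.Ev) (hl : ∀ e, Y.label (g e) = X.label e)
    (hg : ∀ S T : Finset X.Ev, (S, T) ∈ X.confs ↔ (S.map g, T.map g) ∈ Y.confs)
    (hr : Function.Surjective g) : X.Iso Y := by
  have hf : (Equiv.ofBijective g ⟨g.injective, hr⟩).toEmbedding = g := rfl
  exact ⟨.ofBijective g ⟨g.injective, hr⟩, hl, fun S T => by rw [hf]; exact hg S T⟩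

end STData

/-- The path-based translation of a sculpture, with events taken from the bulk, and the translation
through chains of face maps from the bulk cell give isomorphic ST-structures. -/
theorem mainTheorem3 {A : Type u} (X : Sculpture.{u, v} A) (hX : X.H.IsReachable) :
    (X.pathSTBulk.IsSTStructure ∧ X.pathST.IsSTStructure ∧ X.chainST.IsSTStructure) ∧
    X.pathSTBulk.Iso X.chainST ∧
    X.pathST.Iso X.chainST.occurring ∧
    (X.IsSimplistic → X.pathST.Iso X.chainST) := by
  have hl : ∀ e, X.chainST.label (X.pathEvent e) = X.pathST.label e := by
    rintro ⟨q⟩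
    exact X.em.map_label q
  refine ⟨⟨X.chainST_isSTStructure.of_embedding _ (X.mem_pathSTBulk_confs hX),
    X.chainST_isSTStructure.of_embedding _ (X.mem_pathST_confs hX), X.chainST_isSTStructure⟩,
    .of_embedding _ ?_ (X.mem_pathSTBulk_confs hX) (Bulk.eventEquivFin X.L).surjective,
    .occurring_of_embedding X.pathEvent hl (X.mem_pathST_confs hX)
      fun _ => X.chainST_occurs_iff hX,
    fun hs => .of_embedding X.pathEvent hl (X.mem_pathST_confs hX)
      fun e => (X.chainST_occurs_iff hX).mp (X.chainST_occurs_of_isSimplistic hs e)⟩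
  rintro ⟨q⟩
  rfl
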